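/- Let $(R,\mathfrak m)$ be a commutative Noetherian local ring of depth $t$, and let $M$ and $N$ be finitely generated $R$-modules (the zero module has depth $\infty$). Suppose that - $\operatorname{depth}_R M\ge t$; - there is an exact sequence $0\to N\to R^{m}\to Y\to 0$ with $m\in\mathbb N$ and $\operatorname{depth}_R Y\ge t$; - there is an exact sequence $0\to R\to \operatorname{Hom}_R(M,N)^{n}\to X\to 0$ with $n\in\mathbb N$ and $\operatorname{depth}_R X\ge t$; - $\operatorname{Ext}^i_R(M,N)=0$ for all $1\le i\le t-1$. Then $R$ is a direct summand of $N$, i.e. $N\cong R\oplus N'$ for some $R$-module $N'$. -/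

import Mathlib

universe u

namespace HomExt

/-- The depth of a module `M` over a local ring `(R, 𝔪)`: the supremum of the lengths of the
`M`-regular sequences in `𝔪`. For finitely generated `M ≠ 0` the condition
`M ≠ (r₁, …, rₙ) M` is automatic by Nakayama's lemma, so it is not required here; the zero module
thereby has depth `⊤`, the usual convention. -/
noncomputable def depth (R : Type u) [CommRing R] [IsLocalRing R]
    (M : Type u) [AddCommGroup M] [Module R M] : ℕ∞ :=
  ⨆ (rs : List R) (_ : ∀ r ∈ rs, r ∈ IsLocalRing.maximalIdeal R)
    (_ : RingTheory.Sequence.IsWeaklyRegular M rs), (rs.length : ℕ∞)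

/-- `X` is deep: `depth X ≥ depth R`. -/
def IsDeep (R : Type u) [CommRing R] [IsLocalRing R]
    (X : Type u) [AddCommGroup X] [Module R X] : Prop :=
  depth R R ≤ depth R X

/-- `M ∈ Ω Deep(R)`: there is a short exact sequence `0 → M → Rⁿ → X → 0` with `X` deep. -/
def IsSyzygyOfDeep (R : Type u) [CommRing R] [IsLocalRing R]
    (M : Type u) [AddCommGroup M] [Module R M] : Prop :=
  ∃ (n : ℕ) (X : Type u) (_ : AddCommGroup X) (_ : Module R X)
    (f : M →ₗ[R] (Fin n → R)) (g : (Fin n → R) →ₗ[R] X),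
    Function.Injective f ∧ Function.Exact f g ∧ Function.Surjective g ∧ IsDeep R X

/-- `M ∈ DF(R)`, i.e. `M` is deeply faithful: there is a short exact sequence
`0 → R → Mⁿ → X → 0` with `X` deep. -/
def IsDeeplyFaithful (R : Type u) [CommRing R] [IsLocalRing R]
    (M : Type u) [AddCommGroup M] [Module R M] : Prop :=
  ∃ (n : ℕ) (X : Type u) (_ : AddCommGroup X) (_ : Module R X)
    (f : R →ₗ[R] (Fin n → M)) (g : (Fin n → M) →ₗ[R] X),
    Function.Injective f ∧ Function.Exact f g ∧ Function.Surjective g ∧ IsDeep R X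

/-- `M ∣ N`: the module `M` is (isomorphic to) a direct summand of `N`. -/
def IsSummand (R : Type u) [CommRing R]
    (M : Type u) [AddCommGroup M] [Module R M] (N : Type u) [AddCommGroup N] [Module R N] : Prop :=
  ∃ (N' : Type u) (_ : AddCommGroup N') (_ : Module R N'), Nonempty (N ≃ₗ[R] M × N')

end HomExt

/-!
Let `t = depth R`, let `0 → N → Rᵐ → Y → 0` and `0 → R → Hom(M, N)ⁿ → X → 0` be the given sequences,
and let `𝔪` be the maximal ideal. The proof reduces modulo a sequence of length `t` in `𝔪` that is
regular on `R`, `X` and `Y` at once. Such a sequence exists because `Ext^i(R/𝔪, -)` vanishes for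
`i < t` on each of these modules, hence on `R × X × Y`, and the Rees theorem applies to the product
(`exists_common_isWeaklyRegular`). Let `I` be the ideal it generates.

* As the sequence has the maximal possible length, `R/I` has a nonzero socle: there is `s ∉ I` with
  `𝔪 s ⊆ I` (`exists_socle`).
* As the sequence is regular on `X` and `Y`, the maps `R/I → (Hom(M, N)/I)ⁿ` and `N/IN → (R/I)ᵐ`
  are injective (`mem_smul_top_of_map_mem`).
* As the sequence is regular on `N` and `Ext^i(M, N) = 0` for `1 ≤ i < t`, the map
  `Hom(M, N)/I → Hom(M, N/IN)` is injective (`mem_smul_top_of_forall_apply_mem`).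

Following `s` through these injections gives a homomorphism `φ : M → N`, an element `u` of `M` and a
coordinate `c` of `φ u ∈ N ⊆ Rᵐ` with `s c ∉ I`. Since `𝔪 s ⊆ I`, the element `c` is a unit. So that
coordinate is a surjection `N → R`, which splits.
-/

open RingTheory.Sequence CategoryTheory Abelian Pointwise

namespace HomExt

/-! ### Regular sequences and depth -/

theorem exists_isWeaklyRegular_of_le_depth {R : Type u} [CommRing R] [IsLocalRing R]
    {X : Type u} [AddCommGroup X] [Module R X] {t : ℕ} (h : (t : ℕ∞) ≤ depth R X) :
    ∃ rs : List R, rs.length = t ∧ (∀ r ∈ rs, r ∈ IsLocalRing.maximalIdeal R) ∧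
      IsWeaklyRegular X rs := by
  cases t with
  | zero => exact ⟨[], by simp⟩
  | succ s =>
    -- A sequence witnessing `s < depth` may have more than `s + 1` terms, so it is truncated.
    have hs : (s : ℕ∞) < depth R X := lt_of_lt_of_le (by exact_mod_cast Nat.lt_succ_self s) h
    simp only [depth, lt_iSup_iff] at hs
    obtain ⟨rs, hmem, hreg, hlen⟩ := hs
    have hlen : s < rs.length := by exact_mod_cast hlen
    refine ⟨rs.take (s + 1), by simp; omega, fun r hr => hmem r (List.mem_of_mem_take hr), ?_⟩
    rw [← List.take_append_drop (s + 1) rs, isWeaklyRegular_append_iff] at hreg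
    exact hreg.1

theorem length_le_depth {R : Type u} [CommRing R] [IsLocalRing R]
    {X : Type u} [AddCommGroup X] [Module R X] {rs : List R}
    (hmem : ∀ r ∈ rs, r ∈ IsLocalRing.maximalIdeal R) (hreg : IsWeaklyRegular X rs) :
    (rs.length : ℕ∞) ≤ depth R X :=
  le_iSup_of_le rs (le_iSup_of_le hmem (le_iSup_of_le hreg le_rfl))

/-- The direction of the Rees theorem that bounds `Ext` from depth; here `X = 0` is allowed. -/
theorem subsingleton_ext_residue {R : Type u} [CommRing R] [IsLocalRing R] [IsNoetherianRing R]
    {X : Type u} [AddCommGroup X] [Module R X] [Module.Finite R X] {t : ℕ}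
    (h : (t : ℕ∞) ≤ depth R X) (i : ℕ) (hi : i < t) :
    Subsingleton (Ext (ModuleCat.of R (R ⧸ IsLocalRing.maximalIdeal R)) (ModuleCat.of R X) i) := by
  cases subsingleton_or_nontrivial X with
  | inl h0 =>
    have hz : Limits.IsZero (ModuleCat.of R X) := ModuleCat.isZero_of_subsingleton _
    refine subsingleton_of_forall_eq 0 fun x => ?_
    rw [← Ext.comp_mk₀_id x, hz.eq_of_src (𝟙 _) 0, Ext.mk₀_zero, Ext.comp_zero]
  | inr h0 =>
    obtain ⟨rs, hlen, hmem, hreg⟩ := exists_isWeaklyRegular_of_le_depth h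
    have hlt : IsLocalRing.maximalIdeal R • (⊤ : Submodule R (ModuleCat.of R X)) < ⊤ :=
      lt_top_iff_ne_top.mpr (Submodule.top_ne_ideal_smul_of_le_jacobson_annihilator
        (IsLocalRing.maximalIdeal_le_jacobson _)).symm
    refine ModuleCat.subsingleton_ext_of_exists_isRegular (IsLocalRing.maximalIdeal R) _ ?_
      (ModuleCat.of R X) hlt rs hmem
      (RingTheory.Sequence.IsRegular.of_isWeaklyRegular_of_mem_maximalIdeal X hmem hreg) i
      (hlen ▸ hi)
    rw [Module.support_eq_zeroLocus, Ideal.annihilator_quotient]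

theorem subsingleton_ext_prod {R : Type u} [CommRing R]
    {K A B : Type u} [AddCommGroup K] [Module R K]
    [AddCommGroup A] [Module R A] [AddCommGroup B] [Module R B] {i : ℕ}
    (hA : Subsingleton (Ext (ModuleCat.of R K) (ModuleCat.of R A) i))
    (hB : Subsingleton (Ext (ModuleCat.of R K) (ModuleCat.of R B) i)) :
    Subsingleton (Ext (ModuleCat.of R K) (ModuleCat.of R (A × B)) i) := by
  refine subsingleton_of_forall_eq 0 fun x => ?_
  have hid : 𝟙 (ModuleCat.of R (A × B)) =
      ModuleCat.ofHom (LinearMap.fst R A B) ≫ ModuleCat.ofHom (LinearMap.inl R A B) +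
      ModuleCat.ofHom (LinearMap.snd R A B) ≫ ModuleCat.ofHom (LinearMap.inr R A B) := by
    ext x <;> simp
  rw [← Ext.comp_mk₀_id x, hid, Ext.mk₀_add, Ext.comp_add, ← Ext.mk₀_comp_mk₀, ← Ext.mk₀_comp_mk₀,
    ← Ext.comp_assoc_of_third_deg_zero, ← Ext.comp_assoc_of_third_deg_zero,
    Subsingleton.elim (x.comp (Ext.mk₀ (ModuleCat.ofHom (LinearMap.fst R A B))) _) 0,
    Subsingleton.elim (x.comp (Ext.mk₀ (ModuleCat.ofHom (LinearMap.snd R A B))) _) 0]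
  simp

/-- Regular sequences pass to direct summands, since `Z ↦ Z/rZ` is a functor. -/
theorem isWeaklyRegular_of_retract {R : Type*} [CommRing R] {rs : List R} {Z A : Type*}
    [AddCommGroup Z] [Module R Z] [AddCommGroup A] [Module R A]
    (i : A →ₗ[R] Z) (p : Z →ₗ[R] A) (hpi : p ∘ₗ i = LinearMap.id) (h : IsWeaklyRegular Z rs) :
    IsWeaklyRegular A rs := by
  induction h generalizing A with
  | nil => exact .nil R A
  | @cons Z _ _ r rs hr _ ih =>
    have hi : Function.Injective i := fun a b hab => by
      simpa using (LinearMap.congr_fun hpi a).symm.trans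
        ((congrArg p hab).trans (LinearMap.congr_fun hpi b))
    refine .cons (hr.of_injective i hi) (ih (QuotSMulTop.map r i) (QuotSMulTop.map r p) ?_)
    rw [← QuotSMulTop.map_comp, hpi, QuotSMulTop.map_id]

/-- Modules of depth at least `t` share a regular sequence of length `t`: it is found on their
product, whose `Ext` groups from the residue field vanish below degree `t`. The factor `R` keeps
the product nontrivial when `A` and `B` are zero. -/
theorem exists_common_isWeaklyRegular {R : Type u} [CommRing R] [IsLocalRing R]
    [IsNoetherianRing R] {t : ℕ} {A B : Type u} [AddCommGroup A] [Module R A] [Module.Finite R A]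
    [AddCommGroup B] [Module R B] [Module.Finite R B] (hR : (t : ℕ∞) ≤ depth R R)
    (hA : (t : ℕ∞) ≤ depth R A) (hB : (t : ℕ∞) ≤ depth R B) :
    ∃ rs : List R, rs.length = t ∧ (∀ r ∈ rs, r ∈ IsLocalRing.maximalIdeal R) ∧
      IsWeaklyRegular R rs ∧ IsWeaklyRegular A rs ∧ IsWeaklyRegular B rs := by
  have hlt : IsLocalRing.maximalIdeal R • (⊤ : Submodule R (ModuleCat.of R (R × A × B))) < ⊤ :=
    lt_top_iff_ne_top.mpr (Submodule.top_ne_ideal_smul_of_le_jacobson_annihilator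
      (M := R × A × B) (IsLocalRing.maximalIdeal_le_jacobson _)).symm
  obtain ⟨rs, hlen, hmem, hreg⟩ := ModuleCat.exists_isRegular_of_exists_subsingleton_ext
    (IsLocalRing.maximalIdeal R) t (ModuleCat.of R (R × A × B)) hlt
    (ModuleCat.of R (R ⧸ IsLocalRing.maximalIdeal R))
    (by rw [Module.support_eq_zeroLocus, Ideal.annihilator_quotient])
    (fun i hi => subsingleton_ext_prod (subsingleton_ext_residue hR i hi)
      (subsingleton_ext_prod (subsingleton_ext_residue hA i hi)
        (subsingleton_ext_residue hB i hi)))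
  have hreg : IsWeaklyRegular (R × A × B) rs := hreg.toIsWeaklyRegular
  have hAB : IsWeaklyRegular (A × B) rs :=
    isWeaklyRegular_of_retract (LinearMap.inr R R (A × B)) (LinearMap.snd R R (A × B))
      (LinearMap.snd_comp_inr ..) hreg
  exact ⟨rs, hlen, hmem,
    isWeaklyRegular_of_retract (.inl R R (A × B)) (.fst R R (A × B)) (LinearMap.fst_comp_inl ..)
      hreg,
    isWeaklyRegular_of_retract (.inl R A B) (.fst R A B) (LinearMap.fst_comp_inl ..) hAB,
    isWeaklyRegular_of_retract (.inr R A B) (.snd R A B) (LinearMap.snd_comp_inr ..) hAB⟩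

/-- If an `R`-regular sequence has length `depth R`, then the quotient of `R` by it has a nonzero
socle; otherwise some element of the maximal ideal would be regular on the quotient and extend the
sequence. -/
theorem exists_socle {R : Type u} [CommRing R] [IsLocalRing R] [IsNoetherianRing R]
    {rs : List R} (hmem : ∀ r ∈ rs, r ∈ IsLocalRing.maximalIdeal R) (hreg : IsWeaklyRegular R rs)
    (hdepth : depth R R = rs.length) :
    ∃ s ∉ Ideal.ofList rs, ∀ a ∈ IsLocalRing.maximalIdeal R, a * s ∈ Ideal.ofList rs := by
  by_contra! hcon
  -- `R ⧸ (rs • ⊤)`, not `R ⧸ (rs)`, is the quotient in the definition of a regular sequence.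
  have hsub : Subsingleton ((R ⧸ IsLocalRing.maximalIdeal R) →ₗ[R]
      (R ⧸ (Ideal.ofList rs • ⊤ : Ideal R))) := by
    refine subsingleton_of_forall_eq 0 fun f => ?_
    obtain ⟨s, hs⟩ := Submodule.Quotient.mk_surjective _ (f 1)
    have hs0 : s ∈ Ideal.ofList rs := by
      by_contra hs'
      obtain ⟨a, ha, has⟩ := hcon s hs'
      apply has
      have h1 : a • (1 : R ⧸ IsLocalRing.maximalIdeal R) = 0 :=
        (Submodule.Quotient.mk_eq_zero _).mpr (by simpa using ha)
      have h2 : a • f 1 = 0 := by rw [← map_smul, h1, map_zero]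
      rw [← hs, ← Submodule.Quotient.mk_smul, Submodule.Quotient.mk_eq_zero] at h2
      simpa using h2
    have hf1 : f 1 = 0 := by
      rw [← hs, Submodule.Quotient.mk_eq_zero]
      simpa using hs0
    ext
    exact hf1
  obtain ⟨y, hy, hyreg⟩ := IsSMulRegular.subsingleton_linearMap_iff.mp hsub
  rw [Ideal.annihilator_quotient] at hy
  have := length_le_depth (R := R) (X := R) (rs := rs ++ [y])
    (by simpa [or_imp, forall_and] using ⟨hmem, hy⟩)
    ((isWeaklyRegular_append_iff _ _ _).mpr
      ⟨hreg, (isWeaklyRegular_singleton_iff _ _).mpr hyreg⟩)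
  rw [hdepth, Nat.cast_le, List.length_append] at this
  simp at this

/-- If `0 → A → B → C → 0` is exact and `rs` is weakly regular on `C`, then `A/(rs)A → B/(rs)B` is
injective. -/
theorem mem_smul_top_of_map_mem {R : Type*} [CommRing R] {rs : List R} {A B C : Type*}
    [AddCommGroup A] [Module R A] [AddCommGroup B] [Module R B] [AddCommGroup C] [Module R C]
    {f : A →ₗ[R] B} {g : B →ₗ[R] C} (hf : Function.Injective f) (hfg : Function.Exact f g)
    (hg : Function.Surjective g) (hC : IsWeaklyRegular C rs) {a : A}
    (ha : f a ∈ (Ideal.ofList rs • ⊤ : Submodule R B)) :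
    a ∈ (Ideal.ofList rs • ⊤ : Submodule R A) := by
  have h := map_first_exact_on_four_term_right_exact_of_isSMulRegular_last
    (f₁ := (0 : PUnit →ₗ[R] A)) (LinearMap.exact_zero_iff_injective _ _ |>.mpr hf) hfg hg hC
  obtain ⟨x, hx⟩ := (h (Submodule.Quotient.mk a)).mp
    (by simpa [Submodule.Quotient.mk_eq_zero] using ha)
  rw [← Submodule.Quotient.mk_eq_zero, ← hx, Subsingleton.elim x 0, map_zero]

/-- If `0 → A → B → C → 0` is exact and `rs` is weakly regular on `B` and `C`, then the sequence
stays exact modulo the first element of `rs`, so `rs` is weakly regular on `A`. -/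
theorem isWeaklyRegular_of_exact {R : Type*} [CommRing R] {rs : List R} {A B C : Type*}
    [AddCommGroup A] [Module R A] [AddCommGroup B] [Module R B] [AddCommGroup C] [Module R C]
    {f : A →ₗ[R] B} {g : B →ₗ[R] C} (hf : Function.Injective f) (hfg : Function.Exact f g)
    (hg : Function.Surjective g) (hB : IsWeaklyRegular B rs) (hC : IsWeaklyRegular C rs) :
    IsWeaklyRegular A rs := by
  induction hB generalizing A C with
  | nil => exact .nil R A
  | @cons B _ _ r rs hr _ ih =>
    rw [isWeaklyRegular_cons_iff] at hC
    refine .cons (hr.of_injective f hf) (ih (f := QuotSMulTop.map r f) ?_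
      (QuotSMulTop.map_exact r hfg hg) (QuotSMulTop.map_surjective r hg) hC.2)
    have h := QuotSMulTop.map_first_exact_on_four_term_exact_of_isSMulRegular_last
      (f₁ := (0 : PUnit →ₗ[R] A)) (LinearMap.exact_zero_iff_injective _ _ |>.mpr hf) hfg hC.1
    rw [map_zero] at h
    exact (LinearMap.exact_zero_iff_injective _ _).mp h

theorem mem_smul_top_pi {R : Type*} [CommRing R] {I : Ideal R} {n : ℕ} {A : Type*}
    [AddCommGroup A] [Module R A] {x : Fin n → A}
    (hx : ∀ i, x i ∈ (I • ⊤ : Submodule R A)) : x ∈ (I • ⊤ : Submodule R (Fin n → A)) := by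
  rw [← Finset.univ_sum_single x]
  refine Submodule.sum_mem _ fun i _ => ?_
  have h : LinearMap.single R (fun _ : Fin n => A) i (x i) ∈
      (I • ⊤ : Submodule R A).map (LinearMap.single R (fun _ : Fin n => A) i) := ⟨_, hx i, rfl⟩
  rw [Submodule.map_smul''] at h
  exact Submodule.smul_mono le_rfl le_top h

/-! ### Reduction of `Hom` modulo a regular sequence -/

theorem exists_lift_quotSMulTop {R : Type u} [CommRing R] {M N : Type u}
    [AddCommGroup M] [Module R M] [AddCommGroup N] [Module R N] {r : R} (hr : IsSMulRegular N r)
    (hExt : Subsingleton (Ext (ModuleCat.of R M) (ModuleCat.of R N) 1))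
    (ψ : M →ₗ[R] QuotSMulTop r N) :
    ∃ θ : M →ₗ[R] N, (r • (⊤ : Submodule R N)).mkQ ∘ₗ θ = ψ := by
  have hS := IsSMulRegular.smulShortComplex_shortExact (M := ModuleCat.of R N) hr
  obtain ⟨x, hx⟩ := Ext.covariant_sequence_exact₃ (ModuleCat.of R M) hS
    (Ext.mk₀ (ModuleCat.ofHom ψ)) (zero_add 1) (hExt.elim _ _)
  obtain ⟨θ, rfl⟩ := (Ext.mk₀_bijective _ _).2 x
  rw [Ext.mk₀_comp_mk₀] at hx
  exact ⟨θ.hom, congrArg ModuleCat.Hom.hom ((Ext.mk₀_bijective _ _).1 hx)⟩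

theorem subsingleton_ext_quotSMulTop {R : Type u} [CommRing R] {M N : Type u}
    [AddCommGroup M] [Module R M] [AddCommGroup N] [Module R N] {r : R} (hr : IsSMulRegular N r)
    {i : ℕ} (h₀ : Subsingleton (Ext (ModuleCat.of R M) (ModuleCat.of R N) i))
    (h₁ : Subsingleton (Ext (ModuleCat.of R M) (ModuleCat.of R N) (i + 1))) :
    Subsingleton (Ext (ModuleCat.of R M) (ModuleCat.of R (QuotSMulTop r N)) i) := by
  have hS := IsSMulRegular.smulShortComplex_shortExact (M := ModuleCat.of R N) hr
  refine subsingleton_of_forall_eq 0 fun x => ?_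
  obtain ⟨y, hy⟩ := Ext.covariant_sequence_exact₃ (ModuleCat.of R M) hS x rfl (h₁.elim _ _)
  have : Subsingleton (Ext (ModuleCat.of R M) (ModuleCat.smulShortComplex (.of R N) r).X₂ i) := h₀
  rw [← hy, Subsingleton.elim y 0, Ext.zero_comp]
  rfl

theorem exists_eq_smul_of_forall_mem {R : Type*} [CommRing R] {M N : Type*}
    [AddCommGroup M] [Module R M] [AddCommGroup N] [Module R N] {r : R} (hr : IsSMulRegular N r)
    {φ : M →ₗ[R] N} (hφ : ∀ u, φ u ∈ r • (⊤ : Submodule R N)) :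
    ∃ χ : M →ₗ[R] N, r • χ = φ := by
  simp only [Submodule.mem_smul_pointwise_iff_exists, Submodule.mem_top, true_and] at hφ
  choose χ hχ using hφ
  refine ⟨{ toFun := χ, map_add' := fun u v => hr ?_, map_smul' := fun a u => hr ?_ }, ?_⟩
  · simp [hχ]
  · simp [hχ, smul_comm r a]
  · ext u
    exact hχ u

/-- If `rs` is weakly regular on `N` and `Ext^i(M, N) = 0` for `1 ≤ i < length rs`, then
`Hom(M, N)/(rs) → Hom(M, N/(rs)N)` is injective. Modulo the first element `r` of `rs`, a
homomorphism `φ` whose values lie in `(rs)N` becomes by induction a combination of homomorphisms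
`M → N/rN`. These lift to `N` because `Ext^1(M, N) = 0`, and the error of lifting is divisible by
`r`. -/
theorem mem_smul_top_of_forall_apply_mem {R : Type u} [CommRing R] {rs : List R} {M N : Type u}
    [AddCommGroup M] [Module R M] [AddCommGroup N] [Module R N] (hreg : IsWeaklyRegular N rs)
    (hExt : ∀ i : ℕ, 1 ≤ i → i < rs.length →
      Subsingleton (Ext (ModuleCat.of R M) (ModuleCat.of R N) i))
    {φ : M →ₗ[R] N} (hφ : ∀ u, φ u ∈ (Ideal.ofList rs • ⊤ : Submodule R N)) :
    φ ∈ (Ideal.ofList rs • ⊤ : Submodule R (M →ₗ[R] N)) := by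
  induction hreg with
  | nil =>
    have : φ = 0 := by ext u; simpa using hφ u
    simp [this]
  | @cons N _ _ r rs hr _ ih =>
    let q : N →ₗ[R] QuotSMulTop r N := (r • (⊤ : Submodule R N)).mkQ
    have hψ : q ∘ₗ φ ∈ (Ideal.ofList rs • ⊤ : Submodule R (M →ₗ[R] QuotSMulTop r N)) := by
      refine ih (fun i hi hlt => subsingleton_ext_quotSMulTop hr (hExt i hi ?_)
        (hExt (i + 1) (by omega) ?_)) fun u => ?_
      · simp; omega
      · simp; omega
      · obtain ⟨a, ha, b, hb, hab⟩ := Submodule.mem_sup.mp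
          ((Ideal.ofList_cons_smul r rs (⊤ : Submodule R N)).le (hφ u))
        have hqa : q a = 0 := (Submodule.Quotient.mk_eq_zero _).mpr ha
        have hqb : q b ∈ (Ideal.ofList rs • ⊤ : Submodule R N).map q := ⟨b, hb, rfl⟩
        rw [Submodule.map_smul''] at hqb
        rw [LinearMap.comp_apply, ← hab, map_add, hqa, zero_add]
        exact Submodule.smul_mono le_rfl le_top hqb
    obtain ⟨θ, hθ, hqθ⟩ : ∃ θ ∈ (Ideal.ofList rs • ⊤ : Submodule R (M →ₗ[R] N)),
        q ∘ₗ θ = q ∘ₗ φ := by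
      -- For `rs = []` the group `Ext^1(M, N)` may be nonzero, but then nothing has to be lifted.
      rcases List.eq_nil_or_concat rs with rfl | hne
      · exact ⟨0, zero_mem _, by
          rw [Ideal.ofList_nil, Submodule.bot_smul, Submodule.mem_bot] at hψ
          rw [hψ, LinearMap.comp_zero]⟩
      · have hsurj : Function.Surjective (LinearMap.compRight R q : (M →ₗ[R] N) →ₗ[R] _) :=
          exists_lift_quotSMulTop hr (hExt 1 le_rfl (by
            obtain ⟨_, _, rfl⟩ := hne
            simp))
        rw [← LinearMap.range_eq_top.mpr hsurj, ← Submodule.map_top, ← Submodule.map_smul''] at hψ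
        exact hψ
    obtain ⟨χ, hχ⟩ := exists_eq_smul_of_forall_mem hr (φ := φ - θ) fun u => by
      rw [← Submodule.Quotient.mk_eq_zero]
      have := LinearMap.congr_fun hqθ u
      simp only [LinearMap.comp_apply] at this
      change q (φ u - θ u) = 0
      rw [map_sub, this, sub_self]
    rw [Ideal.ofList_cons_smul, ← sub_add_cancel φ θ, ← hχ]
    exact Submodule.add_mem_sup (Submodule.smul_mem_pointwise_smul _ _ _ trivial) hθ

/-! ### Splitting off a free summand -/

theorem isSummand_of_surjective {R : Type u} [CommRing R] {N : Type u} [AddCommGroup N]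
    [Module R N] {p : N →ₗ[R] R} (hp : Function.Surjective p) : IsSummand R R N := by
  obtain ⟨e, -⟩ := ((LinearMap.exact_subtype_ker_map p).splitSurjectiveEquiv
    (LinearMap.ker p).injective_subtype ⟨LinearMap.toSpanSingleton R N (hp 1).choose, by
      ext; simp [(hp 1).choose_spec]⟩)
  exact ⟨LinearMap.ker p, _, _, ⟨e.trans (LinearEquiv.prodComm ..)⟩⟩

end HomExt

theorem theorem3p6 (R : Type u) [CommRing R] [IsLocalRing R] [IsNoetherianRing R]
    (t : ℕ) (ht : HomExt.depth R R = t)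
    (M : Type u) [AddCommGroup M] [Module R M] [Module.Finite R M]
    (N : Type u) [AddCommGroup N] [Module R N] [Module.Finite R N]
    (hM : (t : ℕ∞) ≤ HomExt.depth R M)
    (hN : HomExt.IsSyzygyOfDeep R N)
    (hHom : HomExt.IsDeeplyFaithful R (M →ₗ[R] N))
    (hExt : ∀ i : ℕ, 1 ≤ i → i < t →
      Subsingleton (CategoryTheory.Abelian.Ext (ModuleCat.of R M) (ModuleCat.of R N) i)) :
    HomExt.IsSummand R R N := by
  obtain ⟨m, Y, _, _, g, g', hg, hgg', hg', hY⟩ := hN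
  obtain ⟨n, X, _, _, f, f', hf, hff', hf', hX⟩ := hHom
  rw [HomExt.IsDeep, ht] at hX hY
  have : Module.Finite R Y := .of_surjective g' hg'
  have : Module.Finite R X := .of_surjective f' hf'
  obtain ⟨rs, rfl, hmem, hregR, hregX, hregY⟩ :=
    HomExt.exists_common_isWeaklyRegular ht.ge hX hY
  -- The free module is `Rᵐ ⊗ R` with `Rᵐ` flat.
  have hregF : IsWeaklyRegular (Fin m → R) rs :=
    ((TensorProduct.rid R (Fin m → R)).isWeaklyRegular_congr rs).mp hregR.isWeaklyRegular_lTensor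
  have hregN : IsWeaklyRegular N rs := HomExt.isWeaklyRegular_of_exact hg hgg' hg' hregF hregY
  obtain ⟨s, hs, hsocle⟩ := HomExt.exists_socle hmem hregR ht
  obtain ⟨i, hi⟩ : ∃ i, f s i ∉ (Ideal.ofList rs • ⊤ : Submodule R (M →ₗ[R] N)) := by
    by_contra! h
    exact hs (by simpa using
      HomExt.mem_smul_top_of_map_mem hf hff' hf' hregX (HomExt.mem_smul_top_pi h))
  obtain ⟨u, hu⟩ : ∃ u, f s i u ∉ (Ideal.ofList rs • ⊤ : Submodule R N) := by
    by_contra! h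
    exact hi (HomExt.mem_smul_top_of_forall_apply_mem hregN hExt h)
  obtain ⟨j, hj⟩ : ∃ j, g (f s i u) j ∉ Ideal.ofList rs := by
    by_contra! h
    exact hu (HomExt.mem_smul_top_of_map_mem hg hgg' hg' hregY
      (HomExt.mem_smul_top_pi (by simpa using h)))
  have hfs : f s = s • f 1 := by rw [← map_smul, smul_eq_mul, mul_one]
  have hunit : IsUnit (g (f 1 i u) j) := by
    by_contra h
    apply hj
    simpa [hfs, mul_comm] using hsocle _ ((IsLocalRing.mem_maximalIdeal _).mpr h)
  refine HomExt.isSummand_of_surjective (p := LinearMap.proj j ∘ₗ g) fun a => ?_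
  obtain ⟨v, hv⟩ := hunit.exists_left_inv
  exact ⟨(a * v) • f 1 i u, by simp [mul_assoc, hv]⟩
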